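/- Let $S_m$ ($m\ge 0$) be the star graph with one central vertex $v_0$ and $m$ external vertices (leaves) $v_1,\dots,v_m$, where $e_i$ is the edge from $v_0$ to $v_i$. Let $(\mathcal G,S_m)$ be a graph of groups whose vertex groups $K_0,K_1,\dots,K_m$ are free abelian of finite rank and whose edge groups are cyclic; for $i=1,\dots,m$ let $k_i$ be a generator of the edge group of $e_i$, and let $\alpha_{e_i}$ and $\omega_{e_i}$ be the monomorphisms of this edge group into $K_0$ and $K_i$ respectively. Assume that for every $i=1,\dots,m$ the element $\omega_{e_i}(k_i)$ is primitive in $K_i$, i.e. it is a member of some free generating set (basis) of the free abelian group $K_i$. (In particular the edge groups are infinite cyclic.) Then the fundamental group $\pi_1(\mathcal G,S_m)$ of the graph of groups is linear over $\mathbb Z$: there are an integer $n\ge 0$ and an injective homomorphism $\pi_1(\mathcal G,S_m)\to GL_n(\mathbb Z)$. Here $\pi_1(\mathcal G,\Gamma)$ for a graph of groups on a connected graph $\Gamma$ with maximal subtree $T$ is the quotient of the free product of all vertex groups and of the free group on the (oriented) edges $t_e$ by the relations $t_e\alpha_e(g)t_e^{-1}=\alpha_{\bar e}(g)$ ($g\in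 G_e$) and $t_et_{\bar e}=1$ for all edges $e$, and $t_e=1$ for the edges $e$ of $T$, where $\bar e$ is the inverse of $e$, $G_e=G_{\bar e}$, $\alpha_e$ is the monomorphism of $G_e$ into the group of the initial vertex of $e$, and $\omega_e=\alpha_{\bar e}$. -/

import Mathlib

universe u v w z

/-- A (multi)graph in the sense of Serre. `Edge` is the type of geometric edges (pairs of mutually
inverse edges); an edge is a pair `(x, b)`, where `b` is one of the two orientations of `x`,
and `init` gives the initial vertex of each edge. -/
structure SerreGraph where
  Vertex : Type u
  Edge : Type v
  init : Edge × Bool → Vertex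

namespace SerreGraph

variable (Γ : SerreGraph.{u, v})

/-- The inverse of an edge. -/
def inv (e : Γ.Edge × Bool) : Γ.Edge × Bool := (e.1, !e.2)

/-- The terminal vertex of an edge. -/
def term (e : Γ.Edge × Bool) : Γ.Vertex := Γ.init (Γ.inv e)

/-- The list of edges is a path from the first vertex to the second one. -/
def IsPath : Γ.Vertex → List (Γ.Edge × Bool) → Γ.Vertex → Prop
  | p, [], q => p = q
  | p, e :: l, q => Γ.init e = p ∧ IsPath (Γ.term e) l q

/-- A path is reduced if no edge of it is followed by its inverse. -/
def IsReduced (l : List (Γ.Edge × Bool)) : Prop :=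
  l.IsChain (fun e f => f ≠ Γ.inv e)

/-- The subgraph with all vertices of `Γ` and the geometric edges in `T` is a tree, i.e. it is a
maximal subtree of the (then connected) graph `Γ`: it is nonempty, and any two vertices are
joined by exactly one reduced path in it. -/
def IsMaximalSubtree (T : Set Γ.Edge) : Prop :=
  Nonempty Γ.Vertex ∧
    ∀ p q : Γ.Vertex, ∃! l : List (Γ.Edge × Bool),
      Γ.IsPath p l q ∧ Γ.IsReduced l ∧ ∀ e ∈ l, e.1 ∈ T

end SerreGraph

/-- A graph of groups. The edge group depends on the geometric edge only, so that an edge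
and its inverse have the same edge group; `mono e` is the monomorphism of the edge group of `e`
into the vertex group of the initial vertex of `e`. -/
structure GraphOfGroups (Γ : SerreGraph.{u, v}) where
  vertexGroup : Γ.Vertex → Type w
  [instVertexGroup : ∀ p, Group (vertexGroup p)]
  edgeGroup : Γ.Edge → Type z
  [instEdgeGroup : ∀ x, Group (edgeGroup x)]
  mono : ∀ e : Γ.Edge × Bool, edgeGroup e.1 →* vertexGroup (Γ.init e)
  mono_injective : ∀ e, Function.Injective (mono e)

attribute [instance] GraphOfGroups.instVertexGroup GraphOfGroups.instEdgeGroup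

namespace GraphOfGroups

variable {Γ : SerreGraph.{u, v}} (𝒢 : GraphOfGroups.{u, v, w, z} Γ)

/-- The free product of all vertex groups and of the free group on the edges. -/
abbrev FreeProd : Type (max u v w) :=
  Monoid.Coprod (Monoid.CoprodI 𝒢.vertexGroup) (FreeGroup (Γ.Edge × Bool))

/-- The inclusion of a vertex group into the free product. -/
def ofVertex (p : Γ.Vertex) : 𝒢.vertexGroup p →* 𝒢.FreeProd :=
  Monoid.Coprod.inl.comp Monoid.CoprodI.of

/-- The generator `t_e` of the free product. -/
def stableLetter (e : Γ.Edge × Bool) : 𝒢.FreeProd :=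
  Monoid.Coprod.inr (FreeGroup.of e)

/-- The relators `t_e α_e(g) t_e⁻¹ α_ē(g)⁻¹` and `t_e t_ē` of the path group. -/
def pathRelators : Set 𝒢.FreeProd :=
  {r | ∃ (e : Γ.Edge × Bool) (g : 𝒢.edgeGroup e.1),
      r = 𝒢.stableLetter e * 𝒢.ofVertex (Γ.init e) (𝒢.mono e g) * (𝒢.stableLetter e)⁻¹ *
        (𝒢.ofVertex (Γ.init (Γ.inv e)) (𝒢.mono (Γ.inv e) g))⁻¹} ∪
  {r | ∃ e : Γ.Edge × Bool, r = 𝒢.stableLetter e * 𝒢.stableLetter (Γ.inv e)}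

/-- The path group of a graph of groups. -/
abbrev PathGroup : Type (max u v w) :=
  𝒢.FreeProd ⧸ Subgroup.normalClosure 𝒢.pathRelators

/-- The set of the elements `t_e` of the path group, for the edges `e` of `T`. -/
def treeRelators (T : Set Γ.Edge) : Set 𝒢.PathGroup :=
  {r | ∃ e : Γ.Edge × Bool, e.1 ∈ T ∧
    r = QuotientGroup.mk' (Subgroup.normalClosure 𝒢.pathRelators) (𝒢.stableLetter e)}

/-- The fundamental group of a graph of groups with respect to a maximal subtree `T`. -/
abbrev FundamentalGroup (T : Set Γ.Edge) : Type (max u v w) :=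
  𝒢.PathGroup ⧸ Subgroup.normalClosure (𝒢.treeRelators T)

end GraphOfGroups

/-- The star graph with `m` leaves: the central vertex is `none`, the external vertices are
`some i`, the edge `(i, false)` leads from the centre to `some i`, and `(i, true)` is its
inverse. -/
def starGraph (m : ℕ) : SerreGraph.{0, 0} where
  Vertex := Option (Fin m)
  Edge := Fin m
  init e := if e.2 then some e.1 else none

/-- The central vertex of the star graph. -/
def starGraph.center (m : ℕ) : (starGraph m).Vertex := (none : Option (Fin m))

/-- The external vertex of the star graph on the geometric edge `i`. -/
def starGraph.leaf {m : ℕ} (i : (starGraph m).Edge) : (starGraph m).Vertex :=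
  (some i : Option (Fin m))

namespace GraphOfGroups

variable {m : ℕ} (𝒢 : GraphOfGroups.{0, 0, w, z} (starGraph m))

/-- The monomorphism of the `i`-th edge group into the central vertex group. -/
def toCentral (i : (starGraph m).Edge) :
    𝒢.edgeGroup i →* 𝒢.vertexGroup (starGraph.center m) :=
  𝒢.mono (i, false)

/-- The monomorphism of the `i`-th edge group into the `i`-th external vertex group. -/
def toExternal (i : (starGraph m).Edge) :
    𝒢.edgeGroup i →* 𝒢.vertexGroup (starGraph.leaf i) :=
  𝒢.mono (i, true)

end GraphOfGroups

/-- The family `b` is a free generating set of the (multiplicatively written) free abelian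
group `A`. -/
def IsFreeAbelianBasis {A : Type w} [Group A] {n : ℕ} (b : Fin n → A) : Prop :=
  ∃ φ : Multiplicative (Fin n → ℤ) ≃* A,
    ∀ i, φ (Multiplicative.ofAdd (Pi.single i 1)) = b i

/-- `A` is a free abelian group of finite rank. -/
def IsFreeAbelianOfFiniteRank (A : Type w) [Group A] : Prop :=
  ∃ (n : ℕ) (b : Fin n → A), IsFreeAbelianBasis b

/-- An element of a free abelian group of finite rank is primitive if it can be extended to a free
generating set. -/
def IsPrimitiveElement {A : Type w} [Group A] (a : A) : Prop :=
  ∃ (n : ℕ) (b : Fin n → A), IsFreeAbelianBasis b ∧ a ∈ Set.range b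

/-- `G` is linear over `ℤ`: it has a faithful representation in some `GL_n(ℤ)`. -/
def IsLinearOverInt (G : Type w) [Group G] : Prop :=
  ∃ (n : ℕ) (ρ : G →* Matrix.GeneralLinearGroup (Fin n) ℤ), Function.Injective ρ

/-! Write `K` for the central group and `A i` for the cyclic subgroup of `K` generated by the image
of `k i`. Primitivity splits the `i`-th external group as `A i × B i` with `B i` free abelian. As `A
i` commutes with `B i`, the normal closure `N` of all `B i` is generated by the conjugates of `B i`
by representatives of the cosets `K ⧸ A i`, and the fundamental group is `N * K`. It therefore
suffices to find a representation in which these conjugates generate their free product and `K` can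
be read off modulo `N`.

The module is `ℤ × K` plus a summand `ℤ^(r i) × U i` for each `i`. `K` acts unipotently on `ℤ × K`,
and on `U i` so that `A i` is trivial and `height` separates `base` from its translates by elements
outside `A i` (`nonempty_cosetModule`). `B i` acts by quadratic unipotents scaled by an integer
functional, `weight i`. Translating the weights by `K` gives one functional per coset. The conjugate
attached to a coset preserves its own functional and raises all the others by at least ten times the
gain when that gain is nonnegative (`le_cosetWeight_conjRep`).

Ping-pong (`conjRep_mem_pingPongSet`) then shows that a nontrivial element of the free product moves
`basepoint`. Since `N` fixes the coordinate in `ℤ × K`, an element acting trivially has trivial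
`K`-part, hence lies in `N` and is trivial (`injective_of_extends`). No normal form for amalgams is
needed. -/

theorem isLinearOverInt_of_injective_end {G : Type w} [Group G] {V : Type*} [AddCommGroup V]
    [Module.Free ℤ V] [Module.Finite ℤ V] (ρ : G →* Module.End ℤ V)
    (hρ : Function.Injective ρ) : IsLinearOverInt G := by
  let b := Module.finBasis ℤ V
  let f : Module.End ℤ V →* Matrix _ _ ℤ := (LinearMap.toMatrixAlgEquiv b).toMonoidHom
  refine ⟨_, (f.comp ρ).toHomUnits, fun g h hgh => hρ ?_⟩
  exact (LinearMap.toMatrixAlgEquiv b).injective (congrArg Units.val hgh)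

/-! ### Modules separating a cyclic subgroup from its other cosets -/

/-- A representation of `K` on a free abelian group of finite rank in which `A` acts trivially,
together with a vector `base` and functionals `height` and `degree` such that `height` is
positive on the translates of `base` by elements outside of `A`. -/
structure CosetModule {K : Type*} [AddCommGroup K] (A : AddSubgroup K) where
  carrier : Type
  [addCommGroup : AddCommGroup carrier]
  [free : Module.Free ℤ carrier]
  [finite : Module.Finite ℤ carrier]
  act : Multiplicative K →* Module.End ℤ carrier
  base : carrier
  height : carrier →ₗ[ℤ] ℤ
  degree : carrier →ₗ[ℤ] ℤ
  act_of_mem : ∀ x ∈ A, act (.ofAdd x) = 1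
  degree_act : ∀ x u, degree (act x u) = degree u
  degree_base : degree base = 1
  height_base : height base = 0
  one_le_height : ∀ x ∉ A, 1 ≤ height (act (.ofAdd x) base)

attribute [instance] CosetModule.addCommGroup CosetModule.free CosetModule.finite

/-- The action of `ℤ^ι` by integral unipotent matrices which preserve a quadratic form. -/
def parabolicRep (ι : Type*) [Fintype ι] :
    Multiplicative (ι → ℤ) →* Module.End ℤ (ℤ × (ι → ℤ) × ℤ) where
  toFun b :=
    { toFun := fun p => (p.1, p.2.1 + p.1 • b.toAdd,
        p.2.2 + p.1 * (b.toAdd ⬝ᵥ b.toAdd) + 2 * (b.toAdd ⬝ᵥ p.2.1))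
      map_add' := fun p q => by
        ext <;> simp [add_smul]
        · ring
        · ring
      map_smul' := fun c p => by
        ext <;> simp [-zsmul_eq_mul]
        · ring
        · ring }
  map_one' := by
    ext <;> simp
  map_mul' b c := by
    refine LinearMap.ext fun p => ?_
    ext
    · simp
    · simp; ring
    · simp [-zsmul_eq_mul, dotProduct_comm c.toAdd b.toAdd]; ring

/-- The action of `ℤ` on functions on `ℤ/d` by translations. -/
def translationRep (d : ℕ) : Multiplicative ℤ →* Module.End ℤ (ZMod d → ℤ) where
  toFun x := LinearMap.funLeft ℤ ℤ (fun c => c - (x.toAdd : ZMod d))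
  map_one' := by ext; simp [LinearMap.funLeft]
  map_mul' x y := by
    refine LinearMap.ext fun f => funext fun c => ?_
    simp [LinearMap.funLeft_apply, sub_sub]

/-- The additive map `x ↦ (a j * x l - a l * x j)`, which vanishes at the multiples of `a`. -/
def wedgeHom {n : ℕ} (a : Fin n → ℤ) : (Fin n → ℤ) →+ (Fin n × Fin n → ℤ) where
  toFun x p := a p.1 * x p.2 - a p.2 * x p.1
  map_zero' := by ext; simp
  map_add' x y := by ext; simp; ring

theorem wedgeHom_eq_zero_of_mem {n : ℕ} {a x : Fin n → ℤ} (hx : x ∈ AddSubgroup.zmultiples a) :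
    wedgeHom a x = 0 := by
  obtain ⟨t, rfl⟩ := AddSubgroup.mem_zmultiples_iff.1 hx
  ext p
  simp [wedgeHom]
  ring

/-- Vanishing minors only make `x` a rational multiple of `a`; divisibility in one coordinate makes
the factor an integer. -/
theorem mem_zmultiples_of_wedgeHom {n : ℕ} {a x : Fin n → ℤ} {l : Fin n} (hl : a l ≠ 0)
    (hx : wedgeHom a x = 0) (hd : a l ∣ x l) : x ∈ AddSubgroup.zmultiples a := by
  obtain ⟨t, ht⟩ := hd
  refine AddSubgroup.mem_zmultiples_iff.2 ⟨t, funext fun j => ?_⟩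
  have := congrFun hx (l, j)
  simp only [wedgeHom, AddMonoidHom.coe_mk, ZeroHom.coe_mk, Pi.zero_apply, ht] at this
  apply mul_left_cancel₀ hl
  simp only [Pi.smul_apply, smul_eq_mul]
  linarith

/-- Two obstructions to lying in the subgroup are added. The squared norm of the minors is the last
coordinate of the parabolic translate of `(1, 0, 0)`, and divisibility by `a l` is tested by whether
translation on `ℤ/d` moves the delta function at `0`. Both are nonnegative, and they vanish together
only on multiples of `a`. -/
theorem nonempty_cosetModule {n : ℕ} (a : Fin n → ℤ) (ha : a ≠ 0) :
    Nonempty (CosetModule (AddSubgroup.zmultiples a)) := by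
  obtain ⟨l, hl⟩ := Function.ne_iff.1 ha
  rw [Pi.zero_apply] at hl
  set d := (a l).natAbs with hd
  have : NeZero d := ⟨Int.natAbs_ne_zero.2 hl⟩
  have hdvd : ∀ y : ℤ, ((y : ZMod d) = 0 ↔ a l ∣ y) := fun y => by
    rw [ZMod.intCast_zmod_eq_zero_iff_dvd, hd, Int.natAbs_dvd]
  let σ₁ : Multiplicative (Fin n → ℤ) →* Module.End ℤ (ℤ × (Fin n × Fin n → ℤ) × ℤ) :=
    (parabolicRep (Fin n × Fin n)).comp (AddMonoidHom.toMultiplicative (wedgeHom a))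
  let σ₂ : Multiplicative (Fin n → ℤ) →* Module.End ℤ (ZMod d → ℤ) :=
    (translationRep d).comp (AddMonoidHom.toMultiplicative (Pi.evalAddMonoidHom (fun _ => ℤ) l))
  let φ₁ : ℤ × (Fin n × Fin n → ℤ) × ℤ →ₗ[ℤ] ℤ :=
    LinearMap.snd ℤ _ _ ∘ₗ LinearMap.snd ℤ _ _
  let pr : ZMod d → (ZMod d → ℤ) →ₗ[ℤ] ℤ := LinearMap.proj
  -- On a delta function this is `0` if the support is `0` and `1` otherwise.
  let φ₂ : (ZMod d → ℤ) →ₗ[ℤ] ℤ := (∑ c, pr c) - pr 0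
  have h₁ : ∀ x, φ₁ (σ₁ (.ofAdd x) (1, 0, 0)) = wedgeHom a x ⬝ᵥ wedgeHom a x := fun x => by
    simp [φ₁, σ₁, parabolicRep]
  have h₂ : ∀ x : Fin n → ℤ, φ₂ (σ₂ (.ofAdd x) (Pi.single 0 1)) =
      if (x l : ZMod d) = 0 then 0 else 1 := fun x => by
    simp [φ₂, pr, σ₂, translationRep, LinearMap.funLeft_apply, Pi.single_apply, sub_eq_zero, eq_comm]
    split_ifs <;> simp
  have hpos : ∀ f : Fin n × Fin n → ℤ, 0 ≤ f ⬝ᵥ f := fun f =>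
    Finset.sum_nonneg fun p _ => mul_self_nonneg _
  refine ⟨{
    carrier := (ℤ × (Fin n × Fin n → ℤ) × ℤ) × (ZMod d → ℤ)
    act :=
      { toFun := fun x => (σ₁ x).prodMap (σ₂ x)
        map_one' := by simp only [map_one]; rfl
        map_mul' := fun x y => by simp only [map_mul]; rfl }
    base := ((1, 0, 0), Pi.single 0 1)
    height := φ₁ ∘ₗ LinearMap.fst ℤ _ _ + φ₂ ∘ₗ LinearMap.snd ℤ _ _
    degree := LinearMap.fst ℤ _ _ ∘ₗ LinearMap.fst ℤ _ _
    act_of_mem := fun x hx => ?_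
    degree_act := fun x u => rfl
    degree_base := rfl
    height_base := ?_
    one_le_height := fun x hx => ?_ }⟩
  · have e₁ : σ₁ (.ofAdd x) = 1 := by
      simp only [σ₁, MonoidHom.comp_apply, AddMonoidHom.toMultiplicative_apply_apply, toAdd_ofAdd,
        wedgeHom_eq_zero_of_mem hx, ofAdd_zero, map_one]
    have e₂ : σ₂ (.ofAdd x) = 1 := by
      have : (x l : ZMod d) = 0 := by
        rw [hdvd]
        obtain ⟨t, rfl⟩ := AddSubgroup.mem_zmultiples_iff.1 hx
        exact ⟨t, by simp [mul_comm]⟩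
      refine LinearMap.ext fun f => funext fun c => ?_
      simp [σ₂, translationRep, LinearMap.funLeft_apply, this]
    change (σ₁ (.ofAdd x)).prodMap (σ₂ (.ofAdd x)) = 1
    rw [e₁, e₂]
    rfl
  · have e₁ := h₁ 0
    have e₂ := h₂ 0
    simp only [ofAdd_zero, map_one, map_zero, zero_dotProduct, Module.End.one_apply] at e₁
    simp only [ofAdd_zero, map_one, Module.End.one_apply, Pi.zero_apply, Int.cast_zero,
      if_true] at e₂
    simp [e₁, e₂]
  · change 1 ≤ φ₁ (σ₁ (.ofAdd x) (1, 0, 0)) + φ₂ (σ₂ (.ofAdd x) (Pi.single 0 1))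
    rw [h₁, h₂]
    split_ifs with h
    · rw [hdvd] at h
      have : wedgeHom a x ⬝ᵥ wedgeHom a x ≠ 0 := fun h0 =>
        hx (mem_zmultiples_of_wedgeHom hl (dotProduct_self_eq_zero.1 h0) h)
      have := hpos (wedgeHom a x)
      omega
    · have := hpos (wedgeHom a x)
      omega

/-! ### The module and the actions of the central and external groups -/

section StarRepModule

variable {I : Type} {K : Type} [AddCommGroup K] (r : I → ℕ)
  {A : I → AddSubgroup K} (U : ∀ i, CosetModule (A i))

/-- The module on which the star of groups with central group `K` and external groups
`A i × ℤ^(r i)` acts. -/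
abbrev StarRepModule : Type := (ℤ × K) × (∀ i, (Fin (r i) → ℤ) × (U i).carrier)

namespace StarRepModule

/-- The action of the central group. -/
def centralRep : Multiplicative K →* Module.End ℤ (StarRepModule r U) where
  toFun x :=
    { toFun := fun v => ((v.1.1, v.1.2 + v.1.1 • x.toAdd),
        fun i => ((v.2 i).1, (U i).act x (v.2 i).2))
      map_add' := fun v w => by
        ext <;> simp [add_smul]
        abel
      map_smul' := fun c v => by
        ext <;> simp [mul_smul] }
  map_one' := by
    refine LinearMap.ext fun v => ?_
    ext <;> simp
  map_mul' x y := by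
    refine LinearMap.ext fun v => ?_
    ext <;> simp
    abel

variable {r U}

theorem centralRep_fst (x : Multiplicative K) (v : StarRepModule r U) :
    (centralRep r U x v).1 = (v.1.1, v.1.2 + v.1.1 • x.toAdd) := rfl

theorem centralRep_coord (x : Multiplicative K) (v : StarRepModule r U) (i : I) :
    ((centralRep r U x v).2 i).1 = (v.2 i).1 := rfl

variable [DecidableEq I]

variable (r U) in
/-- The inclusion of the `i`-th summand. -/
def incl (i : I) : (Fin (r i) → ℤ) × (U i).carrier →ₗ[ℤ] StarRepModule r U :=
  LinearMap.inr ℤ _ _ ∘ₗ LinearMap.single ℤ (fun i => (Fin (r i) → ℤ) × (U i).carrier) i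

theorem incl_fst (i : I) (p) : (incl r U i p).1 = 0 := rfl

theorem incl_snd_self (i : I) (p) : (incl r U i p).2 i = p := by
  simp [incl]

theorem incl_snd_of_ne {i j : I} (h : j ≠ i) (p) : (incl r U i p).2 j = 0 := by
  simp [incl, h]

theorem centralRep_incl (x : Multiplicative K) (i : I) (p) :
    centralRep r U x (incl r U i p) = incl r U i (p.1, (U i).act x p.2) := by
  refine Prod.ext ?_ (funext fun j => ?_)
  · simp [centralRep_fst, incl_fst]
  · obtain rfl | h := eq_or_ne j i
    · rw [incl_snd_self]
      simp [centralRep, incl_snd_self]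
    · rw [incl_snd_of_ne h]
      simp [centralRep, incl_snd_of_ne h]

variable [Fintype I]

/-- The functional which controls the action of the `i`-th external group. -/
def weight (i : I) : StarRepModule r U →ₗ[ℤ] ℤ where
  toFun v := v.1.1 + 10 * ((U i).height (v.2 i).2 +
    ∑ j ∈ Finset.univ.erase i, (U j).degree (v.2 j).2)
  map_add' v w := by
    simp [Finset.sum_add_distrib]
    ring
  map_smul' c v := by
    simp only [Prod.smul_fst, Prod.smul_snd, Pi.smul_apply, map_smul, smul_eq_mul,
      ← Finset.mul_sum, RingHom.id_apply]
    ring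

/-- The vector added to `v` by the element `b` of the `i`-th external group. -/
def shift (i : I) (b : Fin (r i) → ℤ) (v : StarRepModule r U) : StarRepModule r U :=
  incl r U i (weight i v • b, (weight i v * (b ⬝ᵥ b) + 2 * (b ⬝ᵥ (v.2 i).1)) • (U i).base)

theorem weight_incl_self (i : I) (p) :
    weight i (incl r U i p) = 10 * (U i).height p.2 := by
  have : ∑ j ∈ Finset.univ.erase i, (U j).degree ((incl r U i p).2 j).2 = 0 :=
    Finset.sum_eq_zero fun j hj => by simp [incl_snd_of_ne (Finset.ne_of_mem_erase hj)]
  change (incl r U i p).1.1 + 10 * (_ + _) = _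
  rw [this, incl_snd_self, incl_fst]
  simp

theorem weight_incl_of_ne {i j : I} (h : j ≠ i) (p) :
    weight j (incl r U i p) = 10 * (U i).degree p.2 := by
  have : ∑ k ∈ Finset.univ.erase j, (U k).degree ((incl r U i p).2 k).2 = (U i).degree p.2 := by
    rw [Finset.sum_eq_single_of_mem i (Finset.mem_erase.2 ⟨h.symm, Finset.mem_univ _⟩),
      incl_snd_self]
    intro k _ hk
    simp [incl_snd_of_ne hk]
  change (incl r U i p).1.1 + 10 * (_ + _) = _
  rw [this, incl_snd_of_ne h, incl_fst]
  simp

theorem weight_shift_self (i : I) (b : Fin (r i) → ℤ) (v : StarRepModule r U) :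
    weight i (shift i b v) = 0 := by
  rw [shift, weight_incl_self, map_smul, (U i).height_base, smul_zero, mul_zero]

theorem shift_coord_self (i : I) (b : Fin (r i) → ℤ) (v : StarRepModule r U) :
    ((shift i b v).2 i).1 = weight i v • b := by
  rw [shift, incl_snd_self]

theorem shift_add (i : I) (b : Fin (r i) → ℤ) (v w : StarRepModule r U) :
    shift i b (v + w) = shift i b v + shift i b w := by
  simp only [shift, ← map_add]
  congr 1
  ext1
  · simp [add_smul]
  · simp only [← add_smul, Prod.snd_add, Pi.add_apply, Prod.fst_add, dotProduct_add, map_add]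
    congr 1
    ring

theorem shift_smul (i : I) (b : Fin (r i) → ℤ) (c : ℤ) (v : StarRepModule r U) :
    shift i b (c • v) = c • shift i b v := by
  simp only [shift, ← map_smul]
  congr 1
  ext1
  · simp only [map_smul, smul_assoc, Prod.smul_fst]
  · simp only [Prod.smul_snd, Pi.smul_apply, Prod.smul_fst, dotProduct_smul, map_smul, smul_smul,
      smul_eq_mul]
    congr 1
    ring

theorem shift_zero (i : I) (v : StarRepModule r U) : shift i 0 v = 0 := by
  simp only [shift, smul_zero, dotProduct_zero, zero_dotProduct, mul_zero, add_zero, zero_smul]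
  exact map_zero _

/-- A shift leaves its own weight unchanged because `base` has height `0`, so the quadratic terms
combine by polarization of `b ⬝ᵥ b`. -/
theorem shift_shift (i : I) (b c : Fin (r i) → ℤ) (v : StarRepModule r U) :
    shift i (b + c) v = shift i c v + shift i b (v + shift i c v) := by
  have h₁ : weight i (v + shift i c v) = weight i v := by
    rw [map_add, weight_shift_self, add_zero]
  have h₂ : ((v + shift i c v).2 i).1 = (v.2 i).1 + weight i v • c := by
    rw [Prod.snd_add, Pi.add_apply, Prod.fst_add, shift_coord_self]
  have h₃ : shift i b (v + shift i c v) = incl r U i (weight i v • b,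
      (weight i v * (b ⬝ᵥ b) + 2 * (b ⬝ᵥ ((v.2 i).1 + weight i v • c))) • (U i).base) := by
    rw [shift, h₁, h₂]
  rw [h₃, shift, shift, ← map_add]
  congr 1
  ext1
  · simp only [Prod.fst_add, smul_add, add_comm]
  · simp only [Prod.snd_add, ← add_smul, dotProduct_add, add_dotProduct, dotProduct_smul,
      smul_eq_mul, dotProduct_comm c b]
    congr 1
    ring

variable (r U)

/-- The action of the `i`-th external group. -/
def externalRep (i : I) :
    Multiplicative (Fin (r i) → ℤ) →* Module.End ℤ (StarRepModule r U) where
  toFun b :=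
    { toFun := fun v => v + shift i b.toAdd v
      map_add' := fun v w => by rw [add_add_add_comm, shift_add]
      map_smul' := fun c v => by rw [RingHom.id_apply, smul_add, shift_smul] }
  map_one' := by
    refine LinearMap.ext fun v => ?_
    change v + shift i 0 v = v
    rw [shift_zero, add_zero]
  map_mul' b c := by
    refine LinearMap.ext fun v => ?_
    change v + shift i (b.toAdd + c.toAdd) v =
      (v + shift i c.toAdd v) + shift i b.toAdd (v + shift i c.toAdd v)
    rw [add_assoc, shift_shift]

variable {r U}

theorem externalRep_apply (i : I) (b : Multiplicative (Fin (r i) → ℤ)) (v : StarRepModule r U) :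
    externalRep r U i b v = v + shift i b.toAdd v := rfl

/-- Only the `i`-th summand enters `weight i` through `height`, and there `A i` acts trivially; the
others enter through `degree`, which all of `K` preserves. -/
theorem weight_centralRep {i : I} {x : Multiplicative K} (hx : x.toAdd ∈ A i)
    (v : StarRepModule r U) : weight i (centralRep r U x v) = weight i v := by
  have h := (U i).act_of_mem _ hx
  rw [ofAdd_toAdd] at h
  simp [weight, centralRep, h, (U _).degree_act]

theorem commute_centralRep_externalRep {i : I} {x : Multiplicative K} (hx : x.toAdd ∈ A i)
    (b : Multiplicative (Fin (r i) → ℤ)) :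
    Commute (centralRep r U x) (externalRep r U i b) := by
  refine LinearMap.ext fun v => ?_
  have h := (U i).act_of_mem _ hx
  rw [ofAdd_toAdd] at h
  rw [Module.End.mul_apply, Module.End.mul_apply, externalRep_apply, externalRep_apply, map_add,
    shift, shift, weight_centralRep hx, centralRep_incl, h, centralRep_coord]
  rfl

/-! ### Conjugates of the external groups and the weights of cosets -/

/-- The value of the `i`-th weight on the translate of `v` by the inverse of a representative of
the coset `α.2`. -/
noncomputable def cosetWeight (α : Σ i, K ⧸ A i) (v : StarRepModule r U) : ℤ :=
  weight α.1 (centralRep r U (.ofAdd (-α.2.out)) v)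

variable (r U) in
/-- The action of the conjugate of the external group `α.1` by a representative of the
coset `α.2`. -/
noncomputable def conjRep (α : Σ i, K ⧸ A i) :
    Multiplicative (Fin (r α.1) → ℤ) →* Module.End ℤ (StarRepModule r U) where
  toFun b := centralRep r U (.ofAdd α.2.out) * externalRep r U α.1 b *
    centralRep r U (.ofAdd (-α.2.out))
  map_one' := by
    rw [map_one, mul_one, ← map_mul, ← ofAdd_add, add_neg_cancel, ofAdd_zero, map_one]
  map_mul' b c := by
    have : centralRep r U (.ofAdd (-α.2.out)) * centralRep r U (.ofAdd α.2.out) = 1 := by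
      rw [← map_mul, ← ofAdd_add, neg_add_cancel, ofAdd_zero, map_one]
    calc _ = centralRep r U (.ofAdd α.2.out) * externalRep r U α.1 b *
          (1 * externalRep r U α.1 c) * centralRep r U (.ofAdd (-α.2.out)) := by
            rw [map_mul, one_mul]
            simp only [mul_assoc]
      _ = _ := by
            rw [← this]
            simp only [mul_assoc]

/-- The multiple of the translate of the base vector added to `v` by the element `b` of the
conjugate of an external group. -/
noncomputable def gain (α : Σ i, K ⧸ A i) (b : Fin (r α.1) → ℤ) (v : StarRepModule r U) : ℤ :=
  cosetWeight α v * (b ⬝ᵥ b) + 2 * (b ⬝ᵥ (v.2 α.1).1)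

theorem conjRep_apply (α : Σ i, K ⧸ A i) (b : Multiplicative (Fin (r α.1) → ℤ))
    (v : StarRepModule r U) :
    conjRep r U α b v = v + incl r U α.1 (cosetWeight α v • b.toAdd,
      gain α b.toAdd v • (U α.1).act (.ofAdd α.2.out) (U α.1).base) := by
  have h : centralRep r U (.ofAdd α.2.out) (centralRep r U (.ofAdd (-α.2.out)) v) = v := by
    rw [← Module.End.mul_apply, ← map_mul, ← ofAdd_add, add_neg_cancel, ofAdd_zero, map_one,
      Module.End.one_apply]
  change centralRep r U (.ofAdd α.2.out)
    (externalRep r U α.1 b (centralRep r U (.ofAdd (-α.2.out)) v)) = _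
  rw [externalRep_apply, map_add, h, shift, centralRep_incl, centralRep_coord, map_smul]
  rfl

theorem conjRep_fst (α : Σ i, K ⧸ A i) (b : Multiplicative (Fin (r α.1) → ℤ))
    (v : StarRepModule r U) : (conjRep r U α b v).1 = v.1 := by
  rw [conjRep_apply, Prod.fst_add, incl_fst, add_zero]

theorem conjRep_coord_self (α : Σ i, K ⧸ A i) (b : Multiplicative (Fin (r α.1) → ℤ))
    (v : StarRepModule r U) :
    ((conjRep r U α b v).2 α.1).1 = (v.2 α.1).1 + cosetWeight α v • b.toAdd := by
  rw [conjRep_apply, Prod.snd_add, Pi.add_apply, incl_snd_self, Prod.fst_add]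

theorem conjRep_coord_of_ne (α : Σ i, K ⧸ A i) (b : Multiplicative (Fin (r α.1) → ℤ))
    (v : StarRepModule r U) {i : I} (hi : i ≠ α.1) :
    ((conjRep r U α b v).2 i).1 = (v.2 i).1 := by
  rw [conjRep_apply, Prod.snd_add, Pi.add_apply, incl_snd_of_ne hi, add_zero]

theorem cosetWeight_conjRep (α β : Σ i, K ⧸ A i) (b : Multiplicative (Fin (r α.1) → ℤ))
    (v : StarRepModule r U) :
    cosetWeight β (conjRep r U α b v) = cosetWeight β v +
      weight β.1 (incl r U α.1 (cosetWeight α v • b.toAdd,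
        gain α b.toAdd v • (U α.1).act (.ofAdd (α.2.out - β.2.out)) (U α.1).base)) := by
  rw [cosetWeight, conjRep_apply, map_add, map_add, centralRep_incl, map_smul,
    ← Module.End.mul_apply, ← map_mul, ← ofAdd_add, neg_add_eq_sub]
  rfl

theorem cosetWeight_conjRep_self (α : Σ i, K ⧸ A i) (b : Multiplicative (Fin (r α.1) → ℤ))
    (v : StarRepModule r U) : cosetWeight α (conjRep r U α b v) = cosetWeight α v := by
  rw [cosetWeight_conjRep, weight_incl_self, map_smul, sub_self, ofAdd_zero, map_one,
    Module.End.one_apply, (U α.1).height_base, smul_zero, mul_zero, add_zero]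

/-- For two cosets of the same `A i`, the representatives differ by an element outside `A i`, so the
translated base vector has height at least `1`; for different indices it contributes its degree,
which is `1`. -/
theorem le_cosetWeight_conjRep {α β : Σ i, K ⧸ A i} (h : β ≠ α)
    (b : Multiplicative (Fin (r α.1) → ℤ)) (v : StarRepModule r U)
    (hg : 0 ≤ gain α b.toAdd v) :
    cosetWeight β v + 10 * gain α b.toAdd v ≤ cosetWeight β (conjRep r U α b v) := by
  rw [cosetWeight_conjRep]
  obtain ⟨i, p⟩ := α
  obtain ⟨j, q⟩ := β
  obtain rfl | hij := eq_or_ne j i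
  · have hpq : p.out - q.out ∉ A j := fun hm => h <| by
      have := (QuotientAddGroup.eq (s := A j)).2
        (show -q.out + p.out ∈ A j by rwa [neg_add_eq_sub])
      simp only [QuotientAddGroup.out_eq'] at this
      rw [this]
    rw [weight_incl_self, map_smul, smul_eq_mul]
    have := (U j).one_le_height _ hpq
    nlinarith
  · rw [weight_incl_of_ne hij, map_smul, (U i).degree_act, (U i).degree_base, smul_eq_mul, mul_one]

/-! ### Ping-pong -/

/-- The condition on `v` under which the nontrivial elements of the `α`-th group move `v` into
`pingPongSet α`. -/
def IsOutside (α : Σ i, K ⧸ A i) (v : StarRepModule r U) : Prop :=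
  (∀ β, 0 < cosetWeight β v) ∧ (∀ s, 4 * |(v.2 α.1).1 s| ≤ cosetWeight α v) ∧
    ∀ γ : Σ i, K ⧸ A i, γ.1 ≠ α.1 → ∀ s,
      4 * |(v.2 γ.1).1 s| ≤ cosetWeight γ v ∨ 4 * |(v.2 γ.1).1 s| ≤ cosetWeight α v

/-- The set containing the images of `pingPongSet β`, where `β ≠ α`, under nontrivial elements
of the `α`-th group. -/
def pingPongSet (α : Σ i, K ⧸ A i) : Set (StarRepModule r U) :=
  {v | (∀ β, 0 < cosetWeight β v) ∧ (∃ s, cosetWeight α v ≤ 2 * |(v.2 α.1).1 s|) ∧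
    ∀ γ, γ ≠ α → (∀ s, 4 * |(v.2 γ.1).1 s| ≤ cosetWeight γ v) ∧
      ∀ s, 4 * |(v.2 α.1).1 s| ≤ cosetWeight γ v}

theorem isOutside_of_mem_pingPongSet {α β : Σ i, K ⧸ A i} (h : α ≠ β) {v : StarRepModule r U}
    (hv : v ∈ pingPongSet β) : IsOutside α v := by
  obtain ⟨hpos, -, hv⟩ := hv
  refine ⟨hpos, (hv α h).1, fun γ hγ s => ?_⟩
  -- The coordinate of `β` may be large compared with its own weight, but it is small compared with
  -- that of `α`; this is why `IsOutside` offers an alternative.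
  by_cases hγβ : γ = β
  · subst hγβ
    exact .inr ((hv α h).2 s)
  · exact .inl ((hv γ hγβ).1 s)

/-- Integrality gives `|b s| ≤ b s * b s`, so the small coordinates of `v` cannot let the linear
term cancel more than half of the quadratic one. -/
theorem le_two_mul_gain {α : Σ i, K ⧸ A i} {v : StarRepModule r U}
    (hpos : 0 < cosetWeight α v) (hx : ∀ s, 4 * |(v.2 α.1).1 s| ≤ cosetWeight α v)
    (b : Fin (r α.1) → ℤ) : cosetWeight α v * (b ⬝ᵥ b) ≤ 2 * gain α b v := by
  have : 0 ≤ ∑ s, (cosetWeight α v * (b s * b s) + 4 * (b s * (v.2 α.1).1 s)) := by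
    refine Finset.sum_nonneg fun s _ => ?_
    have h₁ : |b s * (v.2 α.1).1 s| * 4 ≤ |b s| * cosetWeight α v := by
      rw [abs_mul]
      nlinarith [hx s, abs_nonneg (b s)]
    have h₂ : |b s| ≤ b s * b s := by
      rw [← abs_mul_abs_self (b s)]
      nlinarith [Int.le_self_sq |b s|]
    nlinarith [neg_abs_le (b s * (v.2 α.1).1 s)]
  rw [Finset.sum_add_distrib, ← Finset.mul_sum, ← Finset.mul_sum] at this
  simp only [gain, dotProduct]
  linarith

/-- The own weight is unchanged while the own coordinate moves by a nonzero multiple of it, hence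
becomes comparatively large. The gain is at least half of that weight, so every other weight grows
enough to dominate both this coordinate and the unchanged ones. -/
theorem conjRep_mem_pingPongSet {α : Σ i, K ⧸ A i} {v : StarRepModule r U} (hv : IsOutside α v)
    {b : Multiplicative (Fin (r α.1) → ℤ)} (hb : b ≠ 1) :
    conjRep r U α b v ∈ pingPongSet α := by
  obtain ⟨hpos, hx, hv⟩ := hv
  obtain ⟨s₀, hs₀⟩ : ∃ s, b.toAdd s ≠ 0 := Function.ne_iff.1 (show b.toAdd ≠ 0 from hb)
  have hbb : ∀ s, b.toAdd s * b.toAdd s ≤ b.toAdd ⬝ᵥ b.toAdd := fun s =>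
    Finset.single_le_sum (f := fun s => b.toAdd s * b.toAdd s)
      (fun s _ => mul_self_nonneg _) (Finset.mem_univ s)
  have hbb₁ : 1 ≤ b.toAdd ⬝ᵥ b.toAdd := by
    have := hbb s₀
    have : 0 < b.toAdd s₀ * b.toAdd s₀ := mul_self_pos.2 hs₀
    omega
  have hgain := le_two_mul_gain (hpos α) hx b.toAdd
  have hα := hpos α
  have hgain₁ : cosetWeight α v ≤ 2 * gain α b.toAdd v := by nlinarith
  have hnonneg : 0 ≤ gain α b.toAdd v := by omega
  have hgrow : ∀ γ, γ ≠ α → cosetWeight γ v + 10 * gain α b.toAdd v ≤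
      cosetWeight γ (conjRep r U α b v) := fun γ hγ => le_cosetWeight_conjRep hγ b v hnonneg
  -- Here the constant 10 in `weight` is used: with `w` the own weight, `4 * (|x| + w * |b s|) ≤ 5 *
  -- w * (b ⬝ᵥ b)`, which is at most ten times the gain.
  have hcoord : ∀ s, 4 * |((conjRep r U α b v).2 α.1).1 s| ≤ 10 * gain α b.toAdd v := by
    intro s
    rw [conjRep_coord_self]
    have h₁ : |((v.2 α.1).1 + cosetWeight α v • b.toAdd) s| ≤
        |(v.2 α.1).1 s| + cosetWeight α v * |b.toAdd s| := by
      rw [← abs_of_pos hα, ← abs_mul, abs_of_pos hα]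
      exact abs_add_le _ _
    have h₂ : |b.toAdd s| ≤ b.toAdd ⬝ᵥ b.toAdd := by
      have := hbb s
      rw [← abs_mul_abs_self (b.toAdd s)] at this
      nlinarith [Int.le_self_sq |b.toAdd s|]
    have h₃ : cosetWeight α v * |b.toAdd s| ≤ cosetWeight α v * (b.toAdd ⬝ᵥ b.toAdd) :=
      mul_le_mul_of_nonneg_left h₂ hα.le
    have := hx s
    linarith
  refine ⟨fun β => ?_, ⟨s₀, ?_⟩, fun γ hγ => ⟨?_, fun s => ?_⟩⟩
  · by_cases hβ : β = α
    · rw [hβ, cosetWeight_conjRep_self]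
      exact hα
    · have := hgrow β hβ
      have := hpos β
      omega
  · rw [cosetWeight_conjRep_self, conjRep_coord_self]
    have h₁ : cosetWeight α v * |b.toAdd s₀| ≤
        |((v.2 α.1).1 + cosetWeight α v • b.toAdd) s₀| + |(v.2 α.1).1 s₀| := by
      rw [← abs_of_pos hα, ← abs_mul, abs_of_pos hα]
      refine le_trans (le_of_eq ?_) (abs_sub _ _)
      simp
    have h₂ : 1 ≤ |b.toAdd s₀| := Int.one_le_abs hs₀
    have := hx s₀
    nlinarith
  · intro s
    obtain ⟨i, p⟩ := γ
    by_cases hi : i = α.1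
    · subst hi
      have := hgrow _ hγ
      have := hpos ⟨α.1, p⟩
      have := hcoord s
      change 4 * |((conjRep r U α b v).2 α.1).1 s| ≤ _
      omega
    · have := hgrow _ hγ
      have := hpos ⟨i, p⟩
      rw [conjRep_coord_of_ne _ _ _ hi]
      obtain h | h := hv ⟨i, p⟩ hi s <;> simp only at h <;> omega
  · have := hgrow γ hγ
    have := hpos γ
    have := hcoord s
    omega

variable (r U) in
/-- A vector outside of all ping-pong sets. -/
def basepoint : StarRepModule r U := ((1, 0), 0)

theorem cosetWeight_basepoint (α : Σ i, K ⧸ A i) : cosetWeight α (basepoint r U) = 1 := by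
  simp [cosetWeight, weight, basepoint, centralRep]

theorem isOutside_basepoint (α : Σ i, K ⧸ A i) : IsOutside α (basepoint r U) := by
  have h : ∀ (i : I) s, |((basepoint r U).2 i).1 s| = 0 := fun i s => abs_zero
  refine ⟨fun β => ?_, fun s => ?_, fun γ _ s => .inl ?_⟩
  · simp [cosetWeight_basepoint]
  · simp [h, cosetWeight_basepoint]
  · simp [h, cosetWeight_basepoint]

theorem basepoint_notMem_pingPongSet (α : Σ i, K ⧸ A i) : basepoint r U ∉ pingPongSet α := by
  rintro ⟨-, ⟨s, hs⟩, -⟩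
  have h : |((basepoint r U).2 α.1).1 s| = 0 := abs_zero
  rw [h, cosetWeight_basepoint] at hs
  omega

open Monoid in
theorem lift_conjRep_fst
    (n : CoprodI fun α : Σ i, K ⧸ A i => Multiplicative (Fin (r α.1) → ℤ)) :
    ∀ v, (CoprodI.lift (conjRep r U) n v).1 = v.1 := by
  induction n using CoprodI.induction_on with
  | one => intro v; rw [map_one, Module.End.one_apply]
  | of α b => intro v; rw [CoprodI.lift_of, conjRep_fst]
  | mul m n hm hn => intro v; rw [map_mul, Module.End.mul_apply, hm, hn]

-- Induction on the reduced word: adjacent letters have different indices, so the point reached by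
-- the tail is outside for the next letter.
open Monoid in
theorem lift_conjRep_word_basepoint
    (w : CoprodI.Word fun α : Σ i, K ⧸ A i => Multiplicative (Fin (r α.1) → ℤ)) :
    w.toList = [] ∨ ∃ α, w.fstIdx = some α ∧
      CoprodI.lift (conjRep r U) w.prod (basepoint r U) ∈ pingPongSet α := by
  classical
  induction w using CoprodI.Word.consRecOn with
  | empty => exact .inl rfl
  | cons α b w h₁ h₂ ih =>
    refine .inr ⟨α, CoprodI.Word.fstIdx_cons .., ?_⟩
    rw [CoprodI.Word.prod_cons, map_mul, Module.End.mul_apply, CoprodI.lift_of]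
    refine conjRep_mem_pingPongSet ?_ h₂
    obtain h | ⟨β, hβ, h⟩ := ih
    · have : w = CoprodI.Word.empty := CoprodI.Word.ext h
      rw [this, CoprodI.Word.prod_empty, map_one]
      exact isOutside_basepoint α
    · refine isOutside_of_mem_pingPongSet (fun hαβ => h₁ ?_) h
      rw [hβ, hαβ]

open Monoid in
theorem eq_one_of_lift_conjRep_basepoint
    (n : CoprodI fun α : Σ i, K ⧸ A i => Multiplicative (Fin (r α.1) → ℤ))
    (hn : CoprodI.lift (conjRep r U) n (basepoint r U) = basepoint r U) : n = 1 := by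
  classical
  obtain ⟨w, rfl⟩ : ∃ w : CoprodI.Word _, w.prod = n :=
    ⟨CoprodI.Word.equiv n, CoprodI.Word.equiv.symm_apply_apply n⟩
  obtain h | ⟨α, -, h⟩ := lift_conjRep_word_basepoint (U := U) w
  · rw [show w = CoprodI.Word.empty from CoprodI.Word.ext h, CoprodI.Word.prod_empty]
  · rw [hn] at h
    exact absurd h (basepoint_notMem_pingPongSet α)

end StarRepModule

end StarRepModule

/-! ### Factorization of the group and faithfulness -/

section StarRepModule

variable {I : Type} {K : Type} [AddCommGroup K] {r : I → ℕ}
  {A : I → AddSubgroup K} {U : ∀ i, CosetModule (A i)}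

namespace StarRepModule

open Monoid

section

variable {G : Type w} [Group G] (j : Multiplicative K →* G)
  (jB : ∀ i, Multiplicative (Fin (r i) → ℤ) →* G)

/-- The homomorphism from the free product of the conjugates of the external groups. -/
noncomputable def conjHom :
    CoprodI (fun α : Σ i, K ⧸ A i => Multiplicative (Fin (r α.1) → ℤ)) →* G :=
  CoprodI.lift fun α => (MulAut.conj (j (.ofAdd α.2.out))).toMonoidHom.comp (jB α.1)

variable {j jB}

theorem conjHom_of (α : Σ i, K ⧸ A i) (b : Multiplicative (Fin (r α.1) → ℤ)) :
    conjHom j jB (CoprodI.of b) =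
      j (.ofAdd α.2.out) * jB α.1 b * (j (.ofAdd α.2.out))⁻¹ := by
  simp [conjHom]

/-- `K` permutes the cosets, hence the conjugates of the external groups; the choice of
representatives is harmless because `A i` commutes with the `i`-th external group. -/
theorem conj_mem_range_conjHom
    (hcomm : ∀ i (x : Multiplicative K), x.toAdd ∈ A i → ∀ b, Commute (j x) (jB i b))
    (x : Multiplicative K) {g : G} (hg : g ∈ (conjHom (A := A) j jB).range) :
    j x * g * (j x)⁻¹ ∈ (conjHom (A := A) j jB).range := by
  obtain ⟨n, rfl⟩ := hg
  induction n using CoprodI.induction_on with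
  | one => rw [map_one, mul_one, mul_inv_cancel]; exact one_mem _
  | of α b =>
    obtain ⟨i, q⟩ := α
    -- `y` is the chosen representative of the translated coset, and `a` is the discrepancy, which
    -- lies in `A i`.
    let y : Multiplicative K := .ofAdd ((x.toAdd : K ⧸ A i) + q).out
    let a : Multiplicative K := y⁻¹ * (x * .ofAdd q.out)
    have ha : a.toAdd ∈ A i := by
      refine (QuotientAddGroup.eq (s := A i)).1 ?_
      rw [toAdd_mul, QuotientAddGroup.mk_add]
      simp [y]
    have hy : x * .ofAdd q.out = y * a := by simp [a]
    refine ⟨CoprodI.of (i := ⟨i, (x.toAdd : K ⧸ A i) + q⟩) b, ?_⟩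
    rw [conjHom_of, conjHom_of]
    change j y * jB i b * (j y)⁻¹ = _
    have : j x * (j (.ofAdd q.out) * jB i b * (j (.ofAdd q.out))⁻¹) * (j x)⁻¹ =
        j (x * .ofAdd q.out) * jB i b * (j (x * .ofAdd q.out))⁻¹ := by
      rw [map_mul]; group
    have hc : j a * jB i b * (j a)⁻¹ = jB i b := by
      rw [(hcomm i a ha b).eq, mul_inv_cancel_right]
    rw [this, hy, map_mul]
    conv_lhs => rw [← hc]
    group
  | mul m n hm hn =>
    have := mul_mem hm hn
    rw [map_mul]
    convert this using 1
    group

theorem exists_eq_conjHom_mul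
    (hcomm : ∀ i (x : Multiplicative K), x.toAdd ∈ A i → ∀ b, Commute (j x) (jB i b))
    (hgen : ∀ S : Subgroup G, (∀ x, j x ∈ S) → (∀ i b, jB i b ∈ S) → S = ⊤) (g : G) :
    ∃ n x, g = conjHom (A := A) j jB n * j x := by
  let S : Subgroup G :=
    { carrier := {g | ∃ h ∈ (conjHom (A := A) j jB).range, ∃ x, g = h * j x}
      one_mem' := ⟨1, one_mem _, 1, by simp⟩
      mul_mem' := by
        rintro _ _ ⟨h, hh, x, rfl⟩ ⟨h', hh', x', rfl⟩
        refine ⟨h * (j x * h' * (j x)⁻¹), mul_mem hh (conj_mem_range_conjHom hcomm x hh'),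
          x * x', ?_⟩
        rw [map_mul]
        group
      inv_mem' := by
        rintro _ ⟨h, hh, x, rfl⟩
        refine ⟨j x⁻¹ * h⁻¹ * (j x⁻¹)⁻¹, conj_mem_range_conjHom hcomm _ (inv_mem hh), x⁻¹, ?_⟩
        rw [map_inv]
        group }
  have hS : S = ⊤ := hgen S (fun x => ⟨1, one_mem _, x, by simp⟩) fun i b => by
    -- The chosen representative of the zero coset need not be `0`, so its conjugation has to be
    -- undone.
    let x : Multiplicative K := .ofAdd (0 : K ⧸ A i).out
    refine ⟨_, conj_mem_range_conjHom hcomm x⁻¹ ⟨CoprodI.of (i := ⟨i, 0⟩) b, rfl⟩, 1, ?_⟩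
    rw [conjHom_of, map_inv, map_one]
    change _ = (j x)⁻¹ * (j x * jB i b * (j x)⁻¹) * (j x)⁻¹⁻¹ * 1
    group
  obtain ⟨_, ⟨n, rfl⟩, x, h⟩ := hS ▸ Subgroup.mem_top g
  exact ⟨n, x, h⟩

end

variable [DecidableEq I] [Fintype I]

/-- A representation of a group generated by `K` and the external groups, in which `A i`
commutes with the `i`-th external group, is faithful if it restricts to the standard one. -/
theorem injective_of_extends {G : Type w} [Group G] {j : Multiplicative K →* G}
    {jB : ∀ i, Multiplicative (Fin (r i) → ℤ) →* G}
    (hcomm : ∀ i (x : Multiplicative K), x.toAdd ∈ A i → ∀ b, Commute (j x) (jB i b))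
    (hgen : ∀ S : Subgroup G, (∀ x, j x ∈ S) → (∀ i b, jB i b ∈ S) → S = ⊤)
    (ρ : G →* Module.End ℤ (StarRepModule r U)) (hj : ∀ x, ρ (j x) = centralRep r U x)
    (hjB : ∀ i b, ρ (jB i b) = externalRep r U i b) : Function.Injective ρ := by
  rw [injective_iff_map_eq_one]
  intro g hg
  obtain ⟨n, x, rfl⟩ := exists_eq_conjHom_mul (A := A) hcomm hgen g
  have hρ : ρ.comp (conjHom j jB) = CoprodI.lift (conjRep r U) := by
    refine CoprodI.ext_hom _ _ fun α => MonoidHom.ext fun b => ?_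
    simp only [MonoidHom.comp_apply, conjHom_of, CoprodI.lift_of, map_mul, ← map_inv, hj, hjB]
    rfl
  have hn : ∀ v, (ρ (conjHom j jB n) v).1 = v.1 := by
    rw [← MonoidHom.comp_apply, hρ]
    exact lift_conjRep_fst n
  -- The free product fixes the coordinate in `ℤ × K`, whereas `x` sends `(1, 0)` to `(1, x)`.
  have hx : x = 1 := by
    have h := congrArg (fun f => (f (basepoint r U)).1.2) hg
    simp only [map_mul, Module.End.mul_apply, hn, hj, centralRep_fst] at h
    simpa [basepoint] using h
  subst hx
  rw [map_one, mul_one] at hg ⊢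
  rw [← MonoidHom.comp_apply, hρ] at hg
  rw [eq_one_of_lift_conjRep_basepoint n (by rw [hg, Module.End.one_apply]), map_one]

end StarRepModule

end StarRepModule

/-! ### Primitive elements and maximal subtrees of stars -/

/-- A free abelian group of finite rank splits as the product of the cyclic group generated by
a primitive element and a free abelian group. -/
theorem IsPrimitiveElement.exists_splitting {B : Type w} [Group B] {a : B}
    (ha : IsPrimitiveElement a) :
    ∃ (r : ℕ) (j : Multiplicative (Fin r → ℤ) →* B) (p : B →* Multiplicative ℤ)
      (q : B →* Multiplicative (Fin r → ℤ)), (∀ b, q (j b) = b) ∧ (∀ b, p (j b) = 1) ∧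
      p a = .ofAdd 1 ∧ q a = 1 ∧ (∀ b, Commute a (j b)) ∧
      ∀ x, x = a ^ (p x).toAdd * j (q x) := by
  obtain ⟨n, b, ⟨φ, hφ⟩, s, hs⟩ := ha
  obtain _ | r := n
  · exact s.elim0
  have hsa : φ.symm a = .ofAdd (Pi.single s 1) := by
    rw [← hs, ← hφ, MulEquiv.symm_apply_apply]
  let j : (Fin r → ℤ) →+ (Fin (r + 1) → ℤ) :=
    { toFun := fun c => s.insertNth 0 c
      map_zero' := by
        ext t
        refine s.succAboveCases ?_ (fun u => ?_) t <;> simp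
      map_add' := fun c d => by
        ext t
        refine s.succAboveCases ?_ (fun u => ?_) t <;> simp }
  let q : (Fin (r + 1) → ℤ) →+ (Fin r → ℤ) :=
    { toFun := fun c t => c (s.succAbove t)
      map_zero' := rfl
      map_add' := fun _ _ => rfl }
  refine ⟨r, φ.toMonoidHom.comp (AddMonoidHom.toMultiplicative j),
    (AddMonoidHom.toMultiplicative (Pi.evalAddMonoidHom (fun _ => ℤ) s)).comp φ.symm.toMonoidHom,
    (AddMonoidHom.toMultiplicative q).comp φ.symm.toMonoidHom, fun c => ?_, fun c => ?_, ?_, ?_,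
    fun c => ?_, fun x => ?_⟩
  · simp [q, j]
  · simp [j]
  · simp [hsa]
  · simp only [MonoidHom.comp_apply, MulEquiv.coe_toMonoidHom, hsa]
    refine congrArg Multiplicative.ofAdd (funext fun t => ?_)
    simp [q]
  · apply φ.symm.injective
    rw [map_mul, map_mul, mul_comm]
  · apply φ.symm.injective
    rw [map_mul, map_zpow, hsa]
    simp only [MonoidHom.comp_apply, MulEquiv.coe_toMonoidHom, MulEquiv.symm_apply_apply]
    apply Multiplicative.toAdd.injective
    ext t
    refine s.succAboveCases ?_ (fun u => ?_) t <;> simp [j, q]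

/-- Every edge of a star graph belongs to its maximal subtrees. -/
theorem starGraph.eq_univ_of_isMaximalSubtree {m : ℕ} {T : Set (starGraph m).Edge}
    (hT : (starGraph m).IsMaximalSubtree T) : T = Set.univ := by
  refine Set.eq_univ_of_forall fun i => ?_
  -- A leaf can only be entered through its own edge.
  have key : ∀ (l : List ((starGraph m).Edge × Bool)) (p : (starGraph m).Vertex),
      p ≠ starGraph.leaf i → (starGraph m).IsPath p l (starGraph.leaf i) → ∃ e ∈ l, e.1 = i := by
    intro l
    induction l with
    | nil => exact fun p hp h => absurd h hp
    | cons e l ih =>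
      rintro p hp ⟨-, h⟩
      by_cases he : (starGraph m).term e = starGraph.leaf i
      · obtain ⟨j, _ | _⟩ := e
        · exact ⟨_, List.mem_cons_self, Option.some.inj he⟩
        · exact absurd he (Option.some_ne_none _).symm
      · obtain ⟨f, hf, hfi⟩ := ih _ he h
        exact ⟨f, List.mem_cons_of_mem _ hf, hfi⟩
  obtain ⟨l, ⟨hl, -, hlT⟩, -⟩ := hT.2 (starGraph.center m) (starGraph.leaf i)
  obtain ⟨e, he, rfl⟩ := key l _ (Option.some_ne_none _).symm hl
  exact hlT e he

/-! ### Generators and universal property of the fundamental group -/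

namespace GraphOfGroups

section

variable {Γ : SerreGraph.{u, v}} (𝒢 : GraphOfGroups.{u, v, w, z} Γ) (T : Set Γ.Edge)

/-- The homomorphism from a vertex group to the fundamental group. -/
def vertexHom (p : Γ.Vertex) : 𝒢.vertexGroup p →* 𝒢.FundamentalGroup T :=
  (QuotientGroup.mk' _).comp ((QuotientGroup.mk' _).comp (𝒢.ofVertex p))

/-- The projection of the free product to the fundamental group. -/
def freeProdHom : 𝒢.FreeProd →* 𝒢.FundamentalGroup T :=
  (QuotientGroup.mk' _).comp (QuotientGroup.mk' _)

variable {T}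

theorem freeProdHom_stableLetter {e : Γ.Edge × Bool} (he : e.1 ∈ T) :
    𝒢.freeProdHom T (𝒢.stableLetter e) = 1 :=
  (QuotientGroup.eq_one_iff _).2 (Subgroup.subset_normalClosure ⟨e, he, rfl⟩)

theorem vertexHom_mono {e : Γ.Edge × Bool} (he : e.1 ∈ T) (g : 𝒢.edgeGroup e.1) :
    𝒢.vertexHom T _ (𝒢.mono e g) = 𝒢.vertexHom T _ (𝒢.mono (Γ.inv e) g) := by
  have h : 𝒢.freeProdHom T (𝒢.stableLetter e * 𝒢.ofVertex (Γ.init e) (𝒢.mono e g) *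
      (𝒢.stableLetter e)⁻¹ * (𝒢.ofVertex (Γ.init (Γ.inv e)) (𝒢.mono (Γ.inv e) g))⁻¹) = 1 := by
    have h' : QuotientGroup.mk' (Subgroup.normalClosure 𝒢.pathRelators)
        (𝒢.stableLetter e * 𝒢.ofVertex (Γ.init e) (𝒢.mono e g) *
        (𝒢.stableLetter e)⁻¹ * (𝒢.ofVertex (Γ.init (Γ.inv e)) (𝒢.mono (Γ.inv e) g))⁻¹) = 1 :=
      (QuotientGroup.eq_one_iff _).2 (Subgroup.subset_normalClosure (.inl ⟨e, g, rfl⟩))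
    rw [freeProdHom, MonoidHom.comp_apply, h', map_one]
  simp only [map_mul, map_inv, 𝒢.freeProdHom_stableLetter he, one_mul, inv_one, mul_one] at h
  exact mul_inv_eq_one.1 h

theorem eq_top_of_vertexHom_mem (hT : T = Set.univ) (S : Subgroup (𝒢.FundamentalGroup T))
    (hS : ∀ p g, 𝒢.vertexHom T p g ∈ S) : S = ⊤ := by
  have h : S.comap (𝒢.freeProdHom T) = ⊤ := by
    rw [eq_top_iff, ← Monoid.Coprod.range_inl_sup_range_inr, sup_le_iff]
    constructor
    · rintro _ ⟨x, rfl⟩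
      induction x using Monoid.CoprodI.induction_on with
      | one => rw [map_one]; exact one_mem _
      | of p g => exact hS p g
      | mul x y hx hy => rw [map_mul]; exact mul_mem hx hy
    · rintro _ ⟨x, rfl⟩
      induction x using FreeGroup.induction_on with
      | C1 => rw [map_one]; exact one_mem _
      | of e =>
        rw [Subgroup.mem_comap]
        have := 𝒢.freeProdHom_stableLetter (T := T) (e := e) (hT ▸ Set.mem_univ _)
        rw [stableLetter] at this
        rw [this]
        exact one_mem _
      | inv_of e he => rw [map_inv]; exact inv_mem he
      | mul x y hx hy => rw [map_mul]; exact mul_mem hx hy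
  refine eq_top_iff.2 fun g _ => ?_
  obtain ⟨g, rfl⟩ := QuotientGroup.mk'_surjective _ g
  obtain ⟨g, rfl⟩ := QuotientGroup.mk'_surjective _ g
  exact (h ▸ Subgroup.mem_top g : g ∈ S.comap (𝒢.freeProdHom T))

/-- Homomorphisms from the vertex groups which agree on the edge groups extend to the fundamental
group. -/
theorem exists_hom_fundamentalGroup {H : Type*} [Group H] (f : ∀ p, 𝒢.vertexGroup p →* H)
    (hf : ∀ e g, f _ (𝒢.mono e g) = f _ (𝒢.mono (Γ.inv e) g)) :
    ∃ F : 𝒢.FundamentalGroup T →* H, ∀ p g, F (𝒢.vertexHom T p g) = f p g := by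
  let F₀ : 𝒢.FreeProd →* H := Monoid.Coprod.lift (Monoid.CoprodI.lift f) 1
  have h₁ : ∀ p g, F₀ (𝒢.ofVertex p g) = f p g := fun p g => by
    simp [F₀, ofVertex]
  have h₂ : ∀ e, F₀ (𝒢.stableLetter e) = 1 := fun e => by
    simp [F₀, stableLetter]
  have h₃ : Subgroup.normalClosure 𝒢.pathRelators ≤ F₀.ker := by
    refine Subgroup.normalClosure_le_normal ?_
    rintro _ (⟨e, g, rfl⟩ | ⟨e, rfl⟩)
    · simp [MonoidHom.mem_ker, h₁, h₂, hf e g]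
    · simp [MonoidHom.mem_ker, h₂]
  let F₁ : 𝒢.PathGroup →* H := QuotientGroup.lift _ F₀ h₃
  have h₄ : Subgroup.normalClosure (𝒢.treeRelators T) ≤ F₁.ker := by
    refine Subgroup.normalClosure_le_normal ?_
    rintro _ ⟨e, -, rfl⟩
    exact h₂ e
  exact ⟨QuotientGroup.lift _ F₁ h₄, h₁⟩

end

end GraphOfGroups

/-! ### The representation of the fundamental group of the star -/

theorem mainTheorem1 (m : ℕ) (𝒢 : GraphOfGroups.{0, 0, w, z} (starGraph m))
    (hvertex : ∀ p : (starGraph m).Vertex, IsFreeAbelianOfFiniteRank (𝒢.vertexGroup p))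
    (k : ∀ i : (starGraph m).Edge, 𝒢.edgeGroup i)
    (hk : ∀ (i : (starGraph m).Edge) (x : 𝒢.edgeGroup i), x ∈ Subgroup.zpowers (k i))
    (hprim : ∀ i : (starGraph m).Edge, IsPrimitiveElement (𝒢.toExternal i (k i)))
    (T : Set (starGraph m).Edge) (hT : (starGraph m).IsMaximalSubtree T) :
    IsLinearOverInt (𝒢.FundamentalGroup T) := by
  have hT := starGraph.eq_univ_of_isMaximalSubtree hT
  obtain ⟨n, _, e, -⟩ := hvertex (starGraph.center m)
  let _ : DecidableEq (starGraph m).Edge := inferInstanceAs (DecidableEq (Fin m))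
  let _ : Fintype (starGraph m).Edge := inferInstanceAs (Fintype (Fin m))
  choose r j p q hqj hpj hpa hqa hcomm hdecomp using fun i => (hprim i).exists_splitting
  let a : (starGraph m).Edge → Multiplicative (Fin n → ℤ) := fun i => e.symm (𝒢.toCentral i (k i))
  have hea : ∀ i, e (a i) = 𝒢.toCentral i (k i) := fun i => e.apply_symm_apply _
  have ha : ∀ i, (a i).toAdd ≠ 0 := fun i h => by
    -- If the central image were trivial, so would be `k i`; but `p i` sends its external image to a
    -- generator of `ℤ`.
    have h₁ : 𝒢.toCentral i (k i) = 1 := by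
      rw [← hea, show a i = 1 from h, map_one]
    have h₂ : k i = 1 := 𝒢.mono_injective (i, false) (h₁.trans (map_one _).symm)
    have h₃ := hpa i
    rw [h₂, map_one, map_one] at h₃
    exact zero_ne_one (α := ℤ) (congrArg Multiplicative.toAdd h₃)
  let A : (starGraph m).Edge → AddSubgroup (Fin n → ℤ) := fun i => AddSubgroup.zmultiples (a i).toAdd
  let U : ∀ i, CosetModule (A i) := fun i => (nonempty_cosetModule _ (ha i)).some
  let ρ₀ := (StarRepModule.centralRep r U).toHomUnits
  let τ := fun i => (StarRepModule.externalRep r U i).toHomUnits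
  have hρτ : ∀ i b, Commute (ρ₀ (a i)) (τ i b) := fun i b =>
    have h : (a i).toAdd ∈ A i := AddSubgroup.mem_zmultiples _
    Units.ext (StarRepModule.commute_centralRep_externalRep (U := U) h b)
  -- The splitting defines the action of the leaf group; it is multiplicative because the two
  -- factors commute by `hρτ`.
  let fleaf : ∀ i : (starGraph m).Edge, 𝒢.vertexGroup (starGraph.leaf i) →*
      (Module.End ℤ (StarRepModule r U))ˣ := fun i =>
    { toFun := fun x => ρ₀ (a i) ^ (p i x).toAdd * τ i (q i x)
      map_one' := by simp
      map_mul' := fun x y => by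
        rw [map_mul (p i), map_mul (q i), toAdd_mul, zpow_add, map_mul (τ i)]
        exact (((hρτ i _).zpow_left _).mul_mul_mul_comm _ _) }
  let fcenter : 𝒢.vertexGroup (starGraph.center m) →* (Module.End ℤ (StarRepModule r U))ˣ :=
    ρ₀.comp e.symm.toMonoidHom
  let f : ∀ v : (starGraph m).Vertex, 𝒢.vertexGroup v →*
      (Module.End ℤ (StarRepModule r U))ˣ := fun v =>
    match v with
    | none => fcenter
    | some i => fleaf i
  have hgen : ∀ i (g : 𝒢.edgeGroup i),
      ρ₀ (e.symm (𝒢.toCentral i g)) = fleaf i (𝒢.toExternal i g) := fun i g => by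
    obtain ⟨t, rfl⟩ := hk i g
    simp only [map_zpow]
    congr 1
    change ρ₀ (a i) = ρ₀ (a i) ^ (p i (𝒢.toExternal i (k i))).toAdd *
      τ i (q i (𝒢.toExternal i (k i)))
    rw [hpa, hqa, map_one (τ i), mul_one, toAdd_ofAdd, zpow_one]
  obtain ⟨F, hF⟩ := 𝒢.exists_hom_fundamentalGroup (T := T) f (by
    rintro ⟨i, _ | _⟩ g
    · exact hgen i g
    · exact (hgen i g).symm)
  have hamalg : ∀ i, 𝒢.vertexHom T (starGraph.center m) (𝒢.toCentral i (k i)) =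
      𝒢.vertexHom T (starGraph.leaf i) (𝒢.toExternal i (k i)) := fun i =>
    𝒢.vertexHom_mono (e := (i, false)) (hT ▸ Set.mem_univ _) (k i)
  refine isLinearOverInt_of_injective_end ((Units.coeHom _).comp F)
    (StarRepModule.injective_of_extends (A := A)
      (j := (𝒢.vertexHom T (starGraph.center m)).comp e.toMonoidHom)
      (jB := fun i => (𝒢.vertexHom T (starGraph.leaf i)).comp (j i)) ?_ ?_ _ ?_ ?_)
  · intro i x hx b
    obtain ⟨t, ht⟩ := AddSubgroup.mem_zmultiples_iff.1 hx
    have hx : x = a i ^ t := ht.symm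
    rw [hx, map_zpow]
    refine Commute.zpow_left ?_ t
    change Commute (𝒢.vertexHom T (starGraph.center m) (e (a i)))
      (𝒢.vertexHom T (starGraph.leaf i) (j i b))
    rw [hea, hamalg]
    exact (hcomm i b).map (𝒢.vertexHom T (starGraph.leaf i))
  · intro S h₁ h₂
    have hcenter : ∀ x, 𝒢.vertexHom T (starGraph.center m) x ∈ S := fun x => by
      have := h₁ (e.symm x)
      rwa [MonoidHom.comp_apply, MulEquiv.coe_toMonoidHom, e.apply_symm_apply] at this
    have hleaf : ∀ i x, 𝒢.vertexHom T (starGraph.leaf i) x ∈ S := fun i x => by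
      rw [hdecomp i x, map_mul, map_zpow, ← hamalg]
      exact mul_mem (zpow_mem (hcenter _) _) (h₂ i _)
    refine 𝒢.eq_top_of_vertexHom_mem hT S fun v x => ?_
    obtain _ | i := v
    · exact hcenter x
    · exact hleaf i x
  · intro x
    change (F (𝒢.vertexHom T (starGraph.center m) (e x))).val = _
    rw [hF]
    change StarRepModule.centralRep r U (e.symm (e x)) = _
    rw [e.symm_apply_apply]
  · intro i b
    change (F (𝒢.vertexHom T (starGraph.leaf i) (j i b))).val = _
    rw [hF]
    change (ρ₀ (a i) ^ (p i (j i b)).toAdd * τ i (q i (j i b))).val = _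
    rw [hpj, hqj, toAdd_one, zpow_zero, one_mul]
    rfl
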